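/- Let $k$ be a field, let $S=k[x_1,\ldots,x_n]$ with the standard grading, and let $M=(m_1,\ldots,m_q)\subseteq S$ be the ideal generated by monomials $m_1,\ldots,m_q$. Write $\operatorname{codim}(S/M)=\dim S-\dim(S/M)$ (Krull dimensions; $\operatorname{codim}(S/M)$ is not a finite number if $M=S$). For $M\neq S$ and $d=\dim (S/M)$, let $e(S/M)$ denote the multiplicity of $S/M$: if $d\ge 1$, it is $(d-1)!$ times the leading coefficient of the Hilbert polynomial of $S/M$ (which has degree $d-1$), and if $d=0$, it is $\dim_k(S/M)$. (i) If $\operatorname{codim}(S/M)=1$, then $e(S/M)=\deg(\gcd(m_1,\ldots,m_q))$. (ii) If $\operatorname{codim}(S/M)=q$, then $M$ is a complete intersection, namely $m_1,\ldots,m_q$ is a regular sequence in $S$, and $e(S/M)=\prod_{i=1}^q\deg(m_i)$. -/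

import Mathlib

namespace MonomialMultiplicity

open MvPolynomial Filter

/-- The monomial ideal `M = (m_1, …, m_q)` of `S = k[x_1, …, x_n]`. A monomial is given by its
exponent vector `m i : Fin n →₀ ℕ`. -/
noncomputable def monomialIdeal (k : Type*) [Field k] {n q : ℕ} (m : Fin q → Fin n →₀ ℕ) :
    Ideal (MvPolynomial (Fin n) k) :=
  Ideal.span (Set.range fun i => monomial (m i) (1 : k))

/-- The exponent vector of `gcd(m_1, …, m_q)` for `q ≥ 1`: the minimum of the exponents in each
variable. -/
noncomputable def monomialGcd {n q : ℕ} (m : Fin q → Fin n →₀ ℕ) : Fin n →₀ ℕ :=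
  Finsupp.equivFunOnFinite.symm fun j => ⨅ i, m i j

/-- For `q ≥ 1`, a monomial divides the monomial with exponent vector `monomialGcd m` if and only
if it divides every `m_i`. -/
theorem monomial_dvd_monomialGcd_iff (k : Type*) [Field k] {n q : ℕ} [NeZero q]
    (m : Fin q → Fin n →₀ ℕ) (a : Fin n →₀ ℕ) :
    monomial a (1 : k) ∣ monomial (monomialGcd m) 1 ↔
      ∀ i, monomial a (1 : k) ∣ monomial (m i) 1 := by
  have key : a ≤ monomialGcd m ↔ ∀ i, a ≤ m i := by
    constructor
    · intro h i j
      exact (h j).trans (ciInf_le (OrderBot.bddBelow _) i)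
    · intro h j
      exact le_ciInf fun i => h i j
  simpa [monomial_dvd_monomial] using key

/-- `codim(S/I) = c`, that is, `dim(S/I) + c = dim S` (Krull dimensions).
This fails for the unit ideal, whose quotient has dimension `⊥`. -/
def HasCodim {k : Type*} [Field k] {n : ℕ} (I : Ideal (MvPolynomial (Fin n) k)) (c : ℕ) : Prop :=
  ringKrullDim (MvPolynomial (Fin n) k ⧸ I) + c = ringKrullDim (MvPolynomial (Fin n) k)

/-- The Hilbert function of `S/I` for a homogeneous ideal `I`: the `k`-dimension of the degree `i`
component of `S/I`, which is the image of the space of forms of degree `i`. -/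
noncomputable def hilbertFunction {k : Type*} [Field k] {n : ℕ}
    (I : Ideal (MvPolynomial (Fin n) k)) (i : ℕ) : ℕ :=
  Module.finrank k
    ((homogeneousSubmodule (Fin n) k i).map (Ideal.Quotient.mkₐ k I).toLinearMap)

/-- `P` is the Hilbert polynomial of `S/I`: it agrees with the Hilbert function in all large
degrees. -/
def IsHilbertPolynomial {k : Type*} [Field k] {n : ℕ}
    (I : Ideal (MvPolynomial (Fin n) k)) (P : Polynomial ℚ) : Prop :=
  ∀ᶠ i : ℕ in atTop, (hilbertFunction I i : ℚ) = P.eval (i : ℚ)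

/-- `e(S/I) = e` for a proper homogeneous ideal `I`. With `d = dim(S/I)`: if `d = 0`, then `S/I` has
finite length `e` (equivalently, finite dimension `e` over `k`); if `d ≥ 1`, then the Hilbert
polynomial of `S/I` exists, has degree `d - 1`, and has leading coefficient `e / (d - 1)!`. -/
def HasMultiplicity {k : Type*} [Field k] {n : ℕ}
    (I : Ideal (MvPolynomial (Fin n) k)) (e : ℕ) : Prop :=
  ∃ d : ℕ, ringKrullDim (MvPolynomial (Fin n) k ⧸ I) = d ∧
    (d = 0 → Module.Finite k (MvPolynomial (Fin n) k ⧸ I) ∧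
      Module.finrank k (MvPolynomial (Fin n) k ⧸ I) = e) ∧
    (1 ≤ d → ∃ P : Polynomial ℚ, IsHilbertPolynomial I P ∧ P.natDegree = d - 1 ∧
      ((d - 1).factorial : ℚ) * P.leadingCoeff = e)

/-- The multiplicity is unique. -/
theorem HasMultiplicity.unique {k : Type*} [Field k] {n : ℕ}
    {I : Ideal (MvPolynomial (Fin n) k)} {e e' : ℕ}
    (h : HasMultiplicity I e) (h' : HasMultiplicity I e') : e = e' := by
  obtain ⟨d, hd, h0, h1⟩ := h
  obtain ⟨d', hd', h0', h1'⟩ := h'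
  have hdd : d = d' := by
    have := hd.symm.trans hd'
    exact_mod_cast this
  subst hdd
  rcases Nat.eq_zero_or_pos d with h | h
  · exact (h0 h).2.symm.trans (h0' h).2
  · obtain ⟨P, hP, -, hPe⟩ := h1 h
    obtain ⟨Q, hQ, -, hQe⟩ := h1' h
    have hPQ : P = Q := by
      obtain ⟨N, hN⟩ := eventually_atTop.1 (hP.and hQ)
      refine Polynomial.eq_of_infinite_eval_eq P Q ?_
      refine Set.Infinite.mono (s := (fun i : ℕ => (i : ℚ)) '' Set.Ici N) ?_
        ((Set.Ici_infinite N).image (Nat.cast_injective.injOn))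
      rintro _ ⟨i, hi, rfl⟩
      exact (hN i hi).1.symm.trans (hN i hi).2
    subst hPQ
    exact_mod_cast hPe.symm.trans hQe

end MonomialMultiplicity

namespace MonomialMultiplicity

open MvPolynomial Filter

/-! ### Monomial ideals and their standard monomials -/

/-! The standard monomials, those outside `M`, form a `k`-basis of `S/M`, so everything reduces to
counting exponent vectors. Fix `B` bounding all exponents of the generators. Truncating each entry
at `B` does not affect standardness, and the standard vectors over a truncated vector `c` are `c`
plus any vector supported on the coordinates where `c` equals `B`. If there are `s` such full
coordinates, `c` contributes for large degrees a polynomial of degree `s - 1` with leading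
coefficient `1/(s-1)!` (zero if `s = 0`). Once every `c` has at most `d = dim S/M` full coordinates,
`e(S/M)` is the number of `c` with exactly `d` of them (`hasMultiplicity_of_card_standardBox`).

Dimension is controlled by vertex covers: `dim S/M` is the largest number of variables left out by a
set of variables meeting every generator. In codimension one, a counted `c` has a single non-full
entry, which must be smaller than the corresponding exponent of the gcd. In codimension `q`, the
generators have pairwise disjoint supports, since otherwise `q - 1` variables would cover them. A
counted `c` then amounts to an independent choice, for each `m i`, of a variable and a value below
its exponent in `m i`. -/

theorem mem_monomialIdeal {k : Type*} [Field k] {n q : ℕ} {m : Fin q → Fin n →₀ ℕ}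
    {f : MvPolynomial (Fin n) k} :
    f ∈ monomialIdeal k m ↔ ∀ a ∈ f.support, ∃ i, m i ≤ a := by
  have h := mem_ideal_span_monomial_image (x := f) (s := Set.range m)
  rw [← Set.range_comp] at h
  simpa [monomialIdeal, Function.comp_def] using h

theorem monomial_mem_monomialIdeal {k : Type*} [Field k] {n q : ℕ} {m : Fin q → Fin n →₀ ℕ}
    {a : Fin n →₀ ℕ} : monomial a (1 : k) ∈ monomialIdeal k m ↔ ∃ i, m i ≤ a := by
  classical
  simp [mem_monomialIdeal, support_monomial]

/-- The exponent vectors of the monomials outside the ideal generated by the monomials `m i`. -/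
def standardExponents {n q : ℕ} (m : Fin q → Fin n →₀ ℕ) : Set (Fin n →₀ ℕ) :=
  {a | ∀ i, ∃ j, a j < m i j}

theorem mem_standardExponents {n q : ℕ} {m : Fin q → Fin n →₀ ℕ} {a : Fin n →₀ ℕ} :
    a ∈ standardExponents m ↔ ¬ ∃ i, m i ≤ a := by
  simp [standardExponents, Finsupp.le_def]

/-- The class of a monomial in the quotient by a monomial ideal. -/
noncomputable def monomialClass (k : Type*) [Field k] {n q : ℕ} (m : Fin q → Fin n →₀ ℕ)
    (a : Fin n →₀ ℕ) : MvPolynomial (Fin n) k ⧸ monomialIdeal k m :=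
  Ideal.Quotient.mkₐ k (monomialIdeal k m) (monomial a 1)

/-- A polynomial in `M` has all its monomials in `M`, so a combination of standard monomials that
lies in `M` is zero. -/
theorem linearIndepOn_monomialClass (k : Type*) [Field k] {n q : ℕ} (m : Fin q → Fin n →₀ ℕ) :
    LinearIndepOn k (monomialClass k m) (standardExponents m) := by
  rw [linearIndepOn_iff]
  intro l hl h0
  have hf : Finsupp.linearCombination k (monomialClass k m) l =
      Ideal.Quotient.mkₐ k (monomialIdeal k m)
        (Finsupp.linearCombination k (fun a => monomial a (1 : k)) l) := by
    simp [Finsupp.linearCombination_apply, Finsupp.sum, monomialClass, map_sum, map_smul]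
  rw [hf, Ideal.Quotient.mkₐ_eq_mk, Ideal.Quotient.eq_zero_iff_mem, mem_monomialIdeal] at h0
  have hc : ∀ a, coeff a (Finsupp.linearCombination k (fun a => monomial a (1 : k)) l) = l a := by
    classical
    intro a
    simp +contextual [Finsupp.linearCombination_apply, Finsupp.sum, coeff_sum, coeff_monomial]
  ext a
  by_contra hne
  have hne' : l a ≠ 0 := hne
  have hs : a ∈ standardExponents m := hl (Finsupp.mem_support_iff.2 hne')
  exact mem_standardExponents.1 hs (h0 a (by rw [mem_support_iff, hc]; exact hne'))

theorem span_monomialClass_image (k : Type*) [Field k] {n q : ℕ} (m : Fin q → Fin n →₀ ℕ)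
    (A : Set (Fin n →₀ ℕ)) (T : Finset (Fin n →₀ ℕ)) (hT : ↑T = A ∩ standardExponents m) :
    Submodule.span k (monomialClass k m '' A) =
      Submodule.span k (Set.range fun a : T => monomialClass k m a) := by
  apply le_antisymm
  · rw [Submodule.span_le]
    rintro _ ⟨a, ha, rfl⟩
    by_cases hs : a ∈ standardExponents m
    · have : a ∈ T := by
        rw [← Finset.mem_coe, hT]
        exact ⟨ha, hs⟩
      exact Submodule.subset_span ⟨⟨a, this⟩, rfl⟩
    · rw [mem_standardExponents, not_not, ← monomial_mem_monomialIdeal (k := k)] at hs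
      have : monomialClass k m a = 0 := by
        rw [monomialClass, Ideal.Quotient.mkₐ_eq_mk, Ideal.Quotient.eq_zero_iff_mem]
        exact hs
      rw [this]
      exact zero_mem _
  · apply Submodule.span_mono
    rintro _ ⟨⟨a, ha⟩, rfl⟩
    rw [← Finset.mem_coe, hT] at ha
    exact ⟨a, ha.1, rfl⟩

/-- Used with `A` the exponents of a given degree for the Hilbert function, and with `A` everything
for the length. -/
theorem finrank_span_monomialClass_image (k : Type*) [Field k] {n q : ℕ}
    (m : Fin q → Fin n →₀ ℕ) (A : Set (Fin n →₀ ℕ)) (T : Finset (Fin n →₀ ℕ))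
    (hT : ↑T = A ∩ standardExponents m) :
    Module.finrank k (Submodule.span k (monomialClass k m '' A)) = T.card := by
  rw [span_monomialClass_image k m A T hT, finrank_span_eq_card, Fintype.card_coe]
  refine (linearIndepOn_monomialClass k m).mono (t := (T : Set (Fin n →₀ ℕ))) ?_
  rw [hT]
  exact Set.inter_subset_right

theorem map_supported_mk (k : Type*) [Field k] {n q : ℕ} (m : Fin q → Fin n →₀ ℕ)
    (A : Set (Fin n →₀ ℕ)) :
    (AddMonoidAlgebra.supported k k A).map
        (Ideal.Quotient.mkₐ k (monomialIdeal k m)).toLinearMap =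
      Submodule.span k (monomialClass k m '' A) := by
  rw [AddMonoidAlgebra.supported_eq_span_single, Submodule.map_span, Set.image_image]
  rfl

theorem hilbertFunction_monomialIdeal (k : Type*) [Field k] {n q : ℕ}
    (m : Fin q → Fin n →₀ ℕ) (i : ℕ) (T : Finset (Fin n →₀ ℕ))
    (hT : ∀ a, a ∈ T ↔ a.degree = i ∧ a ∈ standardExponents m) :
    hilbertFunction (monomialIdeal k m) i = T.card := by
  rw [hilbertFunction, homogeneousSubmodule_eq_finsupp_supported, map_supported_mk]
  exact finrank_span_monomialClass_image k m _ T (Set.ext fun a => hT a)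

theorem span_monomialClass_univ (k : Type*) [Field k] {n q : ℕ} (m : Fin q → Fin n →₀ ℕ) :
    Submodule.span k (monomialClass k m '' Set.univ) = ⊤ := by
  rw [← map_supported_mk, show AddMonoidAlgebra.supported k k (Set.univ : Set (Fin n →₀ ℕ)) = ⊤
    from eq_top_iff.2 fun f _ => by simp [AddMonoidAlgebra.mem_supported], Submodule.map_top,
    LinearMap.range_eq_top]
  exact Ideal.Quotient.mkₐ_surjective k _

theorem finite_quotient_monomialIdeal (k : Type*) [Field k] {n q : ℕ}
    (m : Fin q → Fin n →₀ ℕ) (T : Finset (Fin n →₀ ℕ)) (hT : ↑T = standardExponents m) :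
    Module.Finite k (MvPolynomial (Fin n) k ⧸ monomialIdeal k m) ∧
      Module.finrank k (MvPolynomial (Fin n) k ⧸ monomialIdeal k m) = T.card := by
  have hT' : (T : Set (Fin n →₀ ℕ)) = Set.univ ∩ standardExponents m := by rw [hT, Set.univ_inter]
  constructor
  · refine ⟨?_⟩
    rw [← span_monomialClass_univ k m, span_monomialClass_image k m _ T hT']
    exact Submodule.fg_span (Set.finite_range _)
  · rw [← finrank_span_monomialClass_image k m _ T hT', span_monomialClass_univ, finrank_top]

/-! ### Krull dimension of the quotient by a monomial ideal -/

/-- Every one of the monomials `m i` is divisible by one of the variables in `T`. -/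
def IsVertexCover {n q : ℕ} (m : Fin q → Fin n →₀ ℕ) (T : Finset (Fin n)) : Prop :=
  ∀ i, ∃ j ∈ T, m i j ≠ 0

theorem ringKrullDim_mvPolynomial_field (k σ : Type*) [Field k] [Finite σ] :
    ringKrullDim (MvPolynomial σ k) = Nat.card σ := by
  rw [MvPolynomial.ringKrullDim_of_isNoetherianRing, ringKrullDim_eq_zero_of_field, zero_add]

/-- Setting the variables in `T` to zero kills `M` and maps `S/M` onto the polynomial ring in the
other variables. -/
theorem IsVertexCover.card_compl_le_ringKrullDim (k : Type*) [Field k] {n q : ℕ}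
    {m : Fin q → Fin n →₀ ℕ} {T : Finset (Fin n)} (hT : IsVertexCover m T) :
    (Tᶜ.card : WithBot ℕ∞) ≤ ringKrullDim (MvPolynomial (Fin n) k ⧸ monomialIdeal k m) := by
  let φ : MvPolynomial (Fin n) k →ₐ[k] MvPolynomial {j // j ∈ Tᶜ} k :=
    aeval fun j => if h : j ∈ Tᶜ then X ⟨j, h⟩ else 0
  have hφ : ∀ f ∈ monomialIdeal k m, φ f = 0 := by
    intro f hf
    have hle : monomialIdeal k m ≤ RingHom.ker φ.toRingHom := by
      rw [monomialIdeal, Ideal.span_le]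
      rintro _ ⟨i, rfl⟩
      obtain ⟨j, hj, hij⟩ := hT i
      change φ (monomial (m i) 1) = 0
      rw [aeval_monomial, Finsupp.prod, Finset.prod_eq_zero (Finsupp.mem_support_iff.2 hij),
        mul_zero]
      simp [hj, hij]
    exact hle hf
  have hsurj : Function.Surjective φ := by
    rw [← AlgHom.range_eq_top, eq_top_iff, ← MvPolynomial.adjoin_range_X, Algebra.adjoin_le_iff]
    rintro _ ⟨⟨j, hj⟩, rfl⟩
    exact ⟨X j, (aeval_X _ _).trans (dif_pos hj)⟩
  have := ringKrullDim_le_of_surjective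
    (Ideal.Quotient.lift (monomialIdeal k m) φ.toRingHom hφ)
    (Ideal.Quotient.lift_surjective_of_surjective _ hφ hsurj)
  rwa [ringKrullDim_mvPolynomial_field, Nat.card_eq_fintype_card, Fintype.card_coe] at this

/-- Take `P` to be the smallest member of a chain of `d + 1` primes containing `I`. -/
theorem exists_prime_le_of_le_ringKrullDim_quotient {R : Type*} [CommRing R] {I : Ideal R} {d : ℕ}
    (h : (d : WithBot ℕ∞) ≤ ringKrullDim (R ⧸ I)) :
    ∃ P : Ideal R, P.IsPrime ∧ I ≤ P ∧ (d : WithBot ℕ∞) ≤ ringKrullDim (R ⧸ P) := by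
  rw [ringKrullDim_quotient, Order.le_krullDim_iff] at h
  obtain ⟨l, hl⟩ := h
  refine ⟨l.head.1.asIdeal, l.head.1.isPrime, l.head.2, ?_⟩
  rw [ringKrullDim_quotient, Order.le_krullDim_iff]
  refine ⟨⟨l.length, fun i => ⟨(l i).1, ?_⟩, fun i => l.step i⟩, hl⟩
  exact l.head_le i

/-- For a prime `P` containing `M`, the variables in `P` form a cover, and the remaining variables
generate `S/P`, which bounds its dimension. -/
theorem exists_isVertexCover_of_le_ringKrullDim {k : Type*} [Field k] {n q : ℕ}
    {m : Fin q → Fin n →₀ ℕ} {d : ℕ}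
    (h : (d : WithBot ℕ∞) ≤ ringKrullDim (MvPolynomial (Fin n) k ⧸ monomialIdeal k m)) :
    ∃ T : Finset (Fin n), IsVertexCover m T ∧ d ≤ Tᶜ.card := by
  classical
  obtain ⟨P, hP, hMP, hd⟩ := exists_prime_le_of_le_ringKrullDim_quotient h
  refine ⟨Finset.univ.filter fun j => (X j : MvPolynomial (Fin n) k) ∈ P, ?_, ?_⟩
  · intro i
    have hi : monomial (m i) (1 : k) ∈ P := hMP (Ideal.subset_span ⟨i, rfl⟩)
    rw [monomial_eq, C_1, one_mul, Finsupp.prod, hP.prod_mem_iff] at hi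
    obtain ⟨j, hj, hjP⟩ := hi
    exact ⟨j, by simpa using hP.mem_of_pow_mem _ hjP, Finsupp.mem_support_iff.1 hj⟩
  · set T := Finset.univ.filter fun j => (X j : MvPolynomial (Fin n) k) ∈ P with hT
    let ψ : MvPolynomial {j // j ∈ Tᶜ} k →ₐ[k] MvPolynomial (Fin n) k ⧸ P :=
      aeval fun j => Ideal.Quotient.mkₐ k P (X j.1)
    have hsurj : Function.Surjective ψ := by
      rw [← AlgHom.range_eq_top, eq_top_iff,
        ← (AlgHom.range_eq_top _).2 (Ideal.Quotient.mkₐ_surjective k P), ← Algebra.map_top,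
        ← MvPolynomial.adjoin_range_X, AlgHom.map_adjoin, Algebra.adjoin_le_iff]
      rintro _ ⟨_, ⟨j, rfl⟩, rfl⟩
      by_cases hj : j ∈ Tᶜ
      · exact ⟨X ⟨j, hj⟩, by simp [ψ]⟩
      · have hj' : (X j : MvPolynomial (Fin n) k) ∈ P := by simpa [hT] using hj
        have h0 : Ideal.Quotient.mkₐ k P (X j) = 0 := by
          rw [Ideal.Quotient.mkₐ_eq_mk, Ideal.Quotient.eq_zero_iff_mem]
          exact hj'
        change Ideal.Quotient.mkₐ k P (X j) ∈ ψ.range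
        rw [h0]
        exact zero_mem _
    have := hd.trans (ringKrullDim_le_of_surjective ψ.toRingHom hsurj)
    rw [ringKrullDim_mvPolynomial_field, Nat.card_eq_fintype_card, Fintype.card_coe] at this
    exact_mod_cast this

theorem HasCodim.exists_ringKrullDim_eq {k : Type*} [Field k] {n c : ℕ}
    {I : Ideal (MvPolynomial (Fin n) k)} (h : HasCodim I c) :
    ∃ d : ℕ, ringKrullDim (MvPolynomial (Fin n) k ⧸ I) = d ∧ d + c = n := by
  rw [HasCodim, ringKrullDim_mvPolynomial_field, Nat.card_eq_fintype_card, Fintype.card_fin] at h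
  generalize ringKrullDim (MvPolynomial (Fin n) k ⧸ I) = D at h
  induction D with
  | bot => simp at h
  | coe D =>
    induction D with
    | top =>
      exfalso
      have h' : ((⊤ + c : ℕ∞) : WithBot ℕ∞) = ((n : ℕ∞) : WithBot ℕ∞) := by exact_mod_cast h
      rw [WithBot.coe_inj, top_add] at h'
      exact ENat.top_ne_natCast n h'
    | coe d =>
      refine ⟨d, rfl, ?_⟩
      exact_mod_cast h

/-! ### Regular sequences of monomials -/

/-- Multiplying by `m r` leaves the exponents of the variables of an earlier `m i` unchanged, so it
cannot create divisibility by `m i`. -/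
theorem isRegular_monomials_of_disjoint (k : Type*) [Field k] {n q : ℕ} {m : Fin q → Fin n →₀ ℕ}
    (hm : ∀ i, m i ≠ 0) (hdisj : ∀ i i' j, m i j ≠ 0 → m i' j ≠ 0 → i = i') :
    RingTheory.Sequence.IsRegular (MvPolynomial (Fin n) k)
      (List.ofFn fun i => monomial (m i) (1 : k)) := by
  classical
  refine ⟨⟨fun r hr => ?_⟩, ?_⟩
  · rw [isSMulRegular_quotient_iff_mem_of_smul_mem]
    have hr' : r < q := by simpa using hr
    have hI : (Ideal.ofList ((List.ofFn fun i => monomial (m i) (1 : k)).take r) • ⊤ :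
        Submodule (MvPolynomial (Fin n) k) (MvPolynomial (Fin n) k)) =
        monomialIdeal k fun i : Fin r => m (i.castLE hr'.le) := by
      rw [Ideal.smul_eq_mul, Ideal.mul_top, Ideal.ofList, monomialIdeal]
      congr 1
      ext f
      rw [Set.mem_ofPred_eq, List.mem_take_iff_getElem]
      simp only [List.getElem_ofFn, List.length_ofFn, Set.mem_range, min_eq_left hr'.le]
      exact ⟨fun ⟨i, hi, h⟩ => ⟨⟨i, hi⟩, h⟩, fun ⟨i, h⟩ => ⟨i, i.2, h⟩⟩
    rw [hI]
    intro f hf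
    rw [List.getElem_ofFn, smul_eq_mul, mem_monomialIdeal] at hf
    rw [mem_monomialIdeal]
    intro a ha
    obtain ⟨i, hi⟩ := hf (m ⟨r, hr'⟩ + a) (by
      rw [mem_support_iff, coeff_monomial_mul, one_mul]
      exact mem_support_iff.1 ha)
    refine ⟨i, fun j => ?_⟩
    by_cases hij : m (i.castLE hr'.le) j = 0
    · rw [hij]
      exact Nat.zero_le _
    · have hrj : m ⟨r, hr'⟩ j = 0 := by
        by_contra hne
        have := congrArg Fin.val (hdisj _ _ j hij hne)
        exact i.2.ne this
      have := hi j
      rwa [Finsupp.add_apply, hrj, zero_add] at this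
  · have hI : (Ideal.ofList (List.ofFn fun i => monomial (m i) (1 : k)) • ⊤ :
        Submodule (MvPolynomial (Fin n) k) (MvPolynomial (Fin n) k)) = monomialIdeal k m := by
      rw [Ideal.smul_eq_mul, Ideal.mul_top, Ideal.ofList, monomialIdeal]
      congr 1
      ext f
      simp [List.mem_ofFn]
    rw [hI]
    intro h
    have h1 : monomial 0 (1 : k) ∈ monomialIdeal k m := h ▸ Submodule.mem_top
    obtain ⟨i, hi⟩ := monomial_mem_monomialIdeal.1 h1
    exact hm i (le_bot_iff.1 hi)

/-! ### Counting standard monomials by truncating exponents -/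

/-- The coordinates in which `c` takes the value `B`. -/
def fullCoords {n : ℕ} (B : ℕ) (c : Fin n → ℕ) : Finset (Fin n) :=
  Finset.univ.filter fun j => c j = B

/-- The standard exponent vectors with all entries at most `B`. -/
def standardBox {n q : ℕ} (m : Fin q → Fin n →₀ ℕ) (B : ℕ) : Finset (Fin n → ℕ) :=
  (Fintype.piFinset fun _ => Finset.range (B + 1)).filter fun c => ∀ i, ∃ j, c j < m i j

theorem mem_standardBox {n q : ℕ} {m : Fin q → Fin n →₀ ℕ} {B : ℕ} {c : Fin n → ℕ} :
    c ∈ standardBox m B ↔ (∀ j, c j ≤ B) ∧ ∀ i, ∃ j, c j < m i j := by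
  simp [standardBox]

/-- The standard exponent vectors of degree `i`. -/
def standardExponentsOfDegree {n q : ℕ} (m : Fin q → Fin n →₀ ℕ) (i : ℕ) :
    Finset (Fin n →₀ ℕ) :=
  (Finset.finsuppAntidiag Finset.univ i).filter fun a => ∀ i, ∃ j, a j < m i j

theorem mem_standardExponentsOfDegree {n q : ℕ} {m : Fin q → Fin n →₀ ℕ} {i : ℕ}
    {a : Fin n →₀ ℕ} :
    a ∈ standardExponentsOfDegree m i ↔ a.degree = i ∧ a ∈ standardExponents m := by
  simp [standardExponentsOfDegree, standardExponents, Finsupp.degree_eq_sum]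

theorem truncate_mem_standardBox {n q : ℕ} {m : Fin q → Fin n →₀ ℕ} {B : ℕ}
    {a : Fin n →₀ ℕ} (ha : a ∈ standardExponents m) :
    (fun j => min (a j) B) ∈ standardBox m B := by
  rw [mem_standardBox]
  refine ⟨fun j => min_le_right _ _, fun i => ?_⟩
  obtain ⟨j, hj⟩ := ha i
  exact ⟨j, (min_le_left _ _).trans_lt hj⟩

theorem mem_standardExponents_of_truncate {n q : ℕ} {m : Fin q → Fin n →₀ ℕ} {B : ℕ}
    (hB : ∀ i j, m i j ≤ B) {a : Fin n →₀ ℕ} (ha : (fun j => min (a j) B) ∈ standardBox m B) :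
    a ∈ standardExponents m := by
  intro i
  obtain ⟨j, hj⟩ := (mem_standardBox.1 ha).2 i
  have := hB i j
  exact ⟨j, by omega⟩

/-- A non-full coordinate of `c` determines the entry of `a`, while a full one only says that the
entry is at least `B`. The excess degree is thus distributed freely over the full coordinates. -/
theorem card_truncate_fiber {n q : ℕ} {m : Fin q → Fin n →₀ ℕ} {B : ℕ}
    (hB : ∀ i j, m i j ≤ B) {c : Fin n → ℕ} (hc : c ∈ standardBox m B) {i : ℕ}
    (hi : ∑ j, c j ≤ i) :
    ((standardExponentsOfDegree m i).filter fun a => (fun j => min (a j) B) = c).card =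
      (Finset.finsuppAntidiag (fullCoords B c) (i - ∑ j, c j)).card := by
  have hcB := (mem_standardBox.1 hc).1
  have hdeg : ∀ b : Fin n →₀ ℕ, b.degree = ∑ j, b j := Finsupp.degree_eq_sum
  symm
  refine Finset.card_bij (fun b _ => Finsupp.equivFunOnFinite.symm c + b) ?_ ?_ ?_
  · intro b hb
    rw [Finset.mem_finsuppAntidiag'] at hb
    have hsum : ∑ j, b j = i - ∑ j, c j := by
      rw [← hb.1, Finsupp.sum_fintype _ _ fun _ => rfl]
    have htr : (fun j => min ((Finsupp.equivFunOnFinite.symm c + b) j) B) = c := by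
      funext j
      simp only [Finsupp.add_apply, Finsupp.equivFunOnFinite_symm_apply_apply]
      by_cases hj : j ∈ fullCoords B c
      · have : c j = B := by simpa [fullCoords] using hj
        omega
      · have : b j = 0 := Finsupp.notMem_support_iff.1 fun h => hj (hb.2 h)
        have := hcB j
        omega
    rw [Finset.mem_filter, mem_standardExponentsOfDegree]
    refine ⟨⟨?_, mem_standardExponents_of_truncate hB (by rw [htr]; exact hc)⟩, htr⟩
    rw [hdeg]
    simp only [Finsupp.add_apply, Finsupp.equivFunOnFinite_symm_apply_apply,
      Finset.sum_add_distrib, hsum]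
    omega
  · intro b _ b' _ h
    exact add_left_cancel h
  · intro a ha
    rw [Finset.mem_filter, mem_standardExponentsOfDegree, hdeg] at ha
    obtain ⟨⟨hai, -⟩, rfl⟩ := ha
    refine ⟨a - Finsupp.equivFunOnFinite.symm (fun j => min (a j) B), ?_, ?_⟩
    · rw [Finset.mem_finsuppAntidiag']
      constructor
      · rw [Finsupp.sum_fintype _ _ fun _ => rfl]
        simp only [Finsupp.tsub_apply, Finsupp.equivFunOnFinite_symm_apply_apply]
        rw [Finset.sum_tsub_distrib _ fun j _ => min_le_left _ _, hai]
      · intro j hj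
        rw [Finsupp.mem_support_iff, Finsupp.tsub_apply,
          Finsupp.equivFunOnFinite_symm_apply_apply] at hj
        simp only [fullCoords, Finset.mem_filter, Finset.mem_univ, true_and]
        omega
    · ext j
      simp only [Finsupp.add_apply, Finsupp.tsub_apply,
        Finsupp.equivFunOnFinite_symm_apply_apply]
      omega

theorem card_standardExponentsOfDegree {n q : ℕ} {m : Fin q → Fin n →₀ ℕ} {B : ℕ}
    (hB : ∀ i j, m i j ≤ B) {i : ℕ} (hi : ∀ c ∈ standardBox m B, ∑ j, c j ≤ i) :
    (standardExponentsOfDegree m i).card =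
      ∑ c ∈ standardBox m B,
        (Finset.finsuppAntidiag (fullCoords B c) (i - ∑ j, c j)).card := by
  rw [Finset.card_eq_sum_card_fiberwise (f := fun a : Fin n →₀ ℕ => fun j => min (a j) B)
    (t := standardBox m B)]
  · exact Finset.sum_congr rfl fun c hc => card_truncate_fiber hB hc (hi c hc)
  · intro a ha
    exact truncate_mem_standardBox (mem_standardExponentsOfDegree.1 ha).2

/-- The polynomial which agrees with `i ↦ #(finsuppAntidiag s (i - t))` for `i > t`. -/
noncomputable def antidiagPoly (s t : ℕ) : Polynomial ℚ :=
  if s = 0 then 0 else Polynomial.preHilbertPoly ℚ (s - 1) t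

theorem eval_antidiagPoly {n : ℕ} (s : Finset (Fin n)) {t i : ℕ} (h : t < i) :
    (antidiagPoly s.card t).eval (i : ℚ) = (Finset.finsuppAntidiag s (i - t)).card := by
  rcases s.eq_empty_or_nonempty with rfl | hs
  -- For empty `s` the count is `1` at `i = t`, so the strict inequality `t < i` is essential.
  · rw [Finset.finsuppAntidiag_empty_of_ne_zero (by omega)]
    simp [antidiagPoly]
  · have hpos := hs.card_pos
    rw [antidiagPoly, if_neg hpos.ne', Polynomial.preHilbertPoly_eq_choose_sub_add _ _ h.le,
      Finset.card_finsuppAntidiag_nat_eq_choose]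
    norm_cast
    rw [show s.card + (i - t) - 1 = (i - t) + (s.card - 1) by omega, Nat.choose_symm_add]

theorem natDegree_antidiagPoly_le {s t d : ℕ} (h : s ≤ d) :
    (antidiagPoly s t).natDegree ≤ d - 1 := by
  unfold antidiagPoly
  split_ifs
  · simp
  · rw [Polynomial.natDegree_preHilbertPoly]
    omega

theorem coeff_antidiagPoly {s t d : ℕ} (hd : 1 ≤ d) (h : s ≤ d) :
    (antidiagPoly s t).coeff (d - 1) = if s = d then ((d - 1).factorial : ℚ)⁻¹ else 0 := by
  unfold antidiagPoly
  split_ifs with h0 h1 h1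
  · omega
  · simp
  · rw [h1, Polynomial.coeff_preHilbertPoly_self]
  · apply Polynomial.coeff_eq_zero_of_natDegree_lt
    rw [Polynomial.natDegree_preHilbertPoly]
    omega

/-- The multiplicity of a monomial ideal counts the truncated standard exponent vectors with the
largest number of full coordinates. -/
theorem hasMultiplicity_of_card_standardBox {k : Type*} [Field k] {n q : ℕ}
    {m : Fin q → Fin n →₀ ℕ} {B d e : ℕ} (hB : ∀ i j, m i j ≤ B)
    (hdim : ringKrullDim (MvPolynomial (Fin n) k ⧸ monomialIdeal k m) = d)
    (hle : ∀ c ∈ standardBox m B, (fullCoords B c).card ≤ d)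
    (he : ((standardBox m B).filter fun c => (fullCoords B c).card = d).card = e) (he0 : e ≠ 0) :
    HasMultiplicity (monomialIdeal k m) e := by
  refine ⟨d, hdim, ?_, ?_⟩
  · rintro rfl
    have hfilter : (standardBox m B).filter (fun c => (fullCoords B c).card = 0) =
        standardBox m B :=
      Finset.filter_true_of_mem fun c hc => Nat.le_zero.1 (hle c hc)
    rw [hfilter] at he
    -- With no full coordinates allowed, truncation changes nothing, so the box already contains
    -- every standard vector.
    have hT : (((standardBox m B).map Finsupp.equivFunOnFinite.symm.toEmbedding :
        Finset (Fin n →₀ ℕ)) : Set (Fin n →₀ ℕ)) = standardExponents m := by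
      ext a
      simp only [Finset.coe_map, Set.mem_image, Finset.mem_coe, Equiv.coe_toEmbedding]
      constructor
      · rintro ⟨c, hc, rfl⟩
        exact (mem_standardBox.1 hc).2
      · intro ha
        have hbox := truncate_mem_standardBox (B := B) ha
        refine ⟨_, hbox, ?_⟩
        ext j
        have hj : j ∉ fullCoords B fun j => min (a j) B := by
          rw [Finset.card_eq_zero.1 (Nat.le_zero.1 (hle _ hbox))]
          exact Finset.notMem_empty j
        simp only [fullCoords, Finset.mem_filter, Finset.mem_univ, true_and] at hj
        simp only [Finsupp.equivFunOnFinite_symm_apply_apply]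
        omega
    have := finite_quotient_monomialIdeal k m _ hT
    rwa [Finset.card_map, he] at this
  · intro hd
    let P : Polynomial ℚ :=
      ∑ c ∈ standardBox m B, antidiagPoly (fullCoords B c).card (∑ j, c j)
    have hcoeff : P.coeff (d - 1) = e * ((d - 1).factorial : ℚ)⁻¹ := by
      rw [Polynomial.finsetSum_coeff,
        Finset.sum_congr rfl fun c hc => coeff_antidiagPoly hd (hle c hc), ← Finset.sum_filter,
        Finset.sum_const, he, nsmul_eq_mul]
    have hfac : ((d - 1).factorial : ℚ) ≠ 0 := by positivity
    have hdeg : P.natDegree = d - 1 := by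
      apply le_antisymm
      · exact Polynomial.natDegree_sum_le_of_forall_le _ _ fun c hc =>
          natDegree_antidiagPoly_le (hle c hc)
      · apply Polynomial.le_natDegree_of_ne_zero
        rw [hcoeff]
        exact mul_ne_zero (Nat.cast_ne_zero.2 he0) (inv_ne_zero hfac)
    refine ⟨P, ?_, hdeg, ?_⟩
    -- A vector in the box has degree at most `n * B`.
    · filter_upwards [eventually_gt_atTop (n * B)] with i hi
      have hlt : ∀ c ∈ standardBox m B, ∑ j, c j < i := by
        intro c hc
        refine lt_of_le_of_lt ?_ hi
        calc ∑ j, c j ≤ ∑ _j : Fin n, B :=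
              Finset.sum_le_sum fun j _ => (mem_standardBox.1 hc).1 j
          _ = n * B := by simp
      rw [hilbertFunction_monomialIdeal k m i _ fun a => mem_standardExponentsOfDegree,
        card_standardExponentsOfDegree hB fun c hc => (hlt c hc).le, Polynomial.eval_finsetSum]
      push_cast
      exact Finset.sum_congr rfl fun c hc => (eval_antidiagPoly _ (hlt c hc)).symm
    · rw [Polynomial.leadingCoeff, hdeg, hcoeff]
      field_simp

theorem exists_bound_exponents {n q : ℕ} (m : Fin q → Fin n →₀ ℕ) : ∃ B, ∀ i j, m i j ≤ B :=
  ⟨∑ i, ∑ j, m i j, fun i j =>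
    (Finset.single_le_sum (f := fun j => m i j) (fun _ _ => Nat.zero_le _) (Finset.mem_univ j)).trans
      (Finset.single_le_sum (f := fun i => ∑ j, m i j) (fun _ _ => Nat.zero_le _)
        (Finset.mem_univ i))⟩

theorem card_add_card_fullCoords_le {n : ℕ} {B : ℕ} {c : Fin n → ℕ} {s : Finset (Fin n)}
    (hs : ∀ j ∈ s, c j < B) : s.card + (fullCoords B c).card ≤ n := by
  have hd : Disjoint s (fullCoords B c) := by
    rw [Finset.disjoint_left]
    intro j hj hj'
    exact (hs j hj).ne (by simpa [fullCoords] using hj')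
  rw [← Finset.card_union_of_disjoint hd]
  simpa using Finset.card_le_univ (s ∪ fullCoords B c)

/-! ### Codimension one -/

theorem monomialGcd_apply {n q : ℕ} (m : Fin q → Fin n →₀ ℕ) (j : Fin n) :
    monomialGcd m j = ⨅ i, m i j := rfl

theorem lt_monomialGcd_apply_iff {n q : ℕ} [NeZero q] {m : Fin q → Fin n →₀ ℕ} {j : Fin n}
    {v : ℕ} : v < monomialGcd m j ↔ ∀ i, v < m i j := by
  rw [monomialGcd_apply]
  constructor
  · intro h i
    exact h.trans_le (ciInf_le (OrderBot.bddBelow _) i)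
  · intro h
    exact Nat.lt_of_succ_le (le_ciInf fun i => h i)

theorem card_standardBox_codim_one {n q d : ℕ} [NeZero q] {m : Fin q → Fin n →₀ ℕ} {B : ℕ}
    (hB : ∀ i j, m i j ≤ B) (hd : d + 1 = n) :
    ((standardBox m B).filter fun c => (fullCoords B c).card = d).card =
      (monomialGcd m).degree := by
  have hgB : ∀ j v, v < monomialGcd m j → v < B := fun j v h =>
    (lt_monomialGcd_apply_iff.1 h 0).trans_le (hB 0 j)
  rw [Finsupp.degree_eq_sum,
    show ∑ j, monomialGcd m j =
      (Finset.univ.sigma fun j => Finset.range (monomialGcd m j)).card by simp]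
  symm
  -- The pair `(j, v)` with `v < monomialGcd m j` corresponds to the vector with entry `v` at `j`
  -- and `B` elsewhere. Full entries are never below an exponent of a generator, so `j` must witness
  -- standardness for every `m i`.
  refine Finset.card_bij (fun p _ => Function.update (fun _ => B) p.1 p.2) ?_ ?_ ?_
  · rintro ⟨j, v⟩ hp
    simp only [Finset.mem_sigma, Finset.mem_univ, true_and, Finset.mem_range] at hp
    have hvB := hgB j v hp
    rw [Finset.mem_filter, mem_standardBox]
    refine ⟨⟨fun l => ?_, fun i => ⟨j, ?_⟩⟩, ?_⟩
    · rcases eq_or_ne l j with rfl | h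
      · simpa using hvB.le
      · simp [h]
    · simpa using lt_monomialGcd_apply_iff.1 hp i
    · have : fullCoords B (Function.update (fun _ => B) j v) = {j}ᶜ := by
        ext l
        rcases eq_or_ne l j with rfl | h
        · simpa [fullCoords] using hvB.ne
        · simp [fullCoords, h]
      rw [this, Finset.card_compl, Finset.card_singleton, Fintype.card_fin]
      omega
  · rintro ⟨j, v⟩ hp ⟨j', v'⟩ hp' h
    simp only [Finset.mem_sigma, Finset.mem_univ, true_and, Finset.mem_range] at hp hp' h
    have hj : j = j' := by
      by_contra hne
      have := congrFun h j
      rw [Function.update_self, Function.update_of_ne hne] at this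
      exact (hgB j v hp).ne this
    subst hj
    have := congrFun h j
    rw [Function.update_self, Function.update_self] at this
    rw [this]
  · intro c hc
    rw [Finset.mem_filter, mem_standardBox] at hc
    obtain ⟨⟨hcB, hcm⟩, hcard⟩ := hc
    have hcompl : (fullCoords B c)ᶜ.card = 1 := by
      rw [Finset.card_compl, hcard, Fintype.card_fin]
      omega
    obtain ⟨j, hj⟩ := Finset.card_eq_one.1 hcompl
    have hfull : ∀ l, l ≠ j → c l = B := by
      intro l hl
      have : l ∉ (fullCoords B c)ᶜ := by simpa [hj] using hl
      simpa [fullCoords] using this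
    refine ⟨⟨j, c j⟩, ?_, ?_⟩
    · simp only [Finset.mem_sigma, Finset.mem_univ, true_and, Finset.mem_range]
      rw [lt_monomialGcd_apply_iff]
      intro i
      obtain ⟨l, hl⟩ := hcm i
      rcases eq_or_ne l j with rfl | h
      · exact hl
      · rw [hfull l h] at hl
        exact absurd (hB i l) (not_le.2 hl)
    · funext l
      rcases eq_or_ne l j with rfl | h
      · simp
      · simp [h, hfull l h]

theorem hasMultiplicity_of_hasCodim_one {k : Type*} [Field k] {n q : ℕ}
    {m : Fin q → Fin n →₀ ℕ} (h : HasCodim (monomialIdeal k m) 1) :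
    HasMultiplicity (monomialIdeal k m) (monomialGcd m).degree := by
  obtain ⟨d, hdim, hdn⟩ := h.exists_ringKrullDim_eq
  obtain ⟨B, hB⟩ := exists_bound_exponents m
  -- Without generators the empty cover gives dimension `n`, contradicting codimension one.
  have hq : q ≠ 0 := by
    rintro rfl
    have := IsVertexCover.card_compl_le_ringKrullDim k (m := m) (T := ∅) fun i => i.elim0
    rw [hdim, Finset.card_compl, Finset.card_empty, Fintype.card_fin] at this
    have : n - 0 ≤ d := by exact_mod_cast this
    omega
  have : NeZero q := ⟨hq⟩
  refine hasMultiplicity_of_card_standardBox hB hdim ?_ (card_standardBox_codim_one hB hdn) ?_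
  · intro c hc
    obtain ⟨j, hj⟩ := (mem_standardBox.1 hc).2 0
    have := card_add_card_fullCoords_le (B := B) (c := c) (s := {j}) (by
      simpa using hj.trans_le (hB 0 j))
    rw [Finset.card_singleton] at this
    omega
  -- A cover with at most one variable exists, and that variable divides every generator, so the gcd
  -- is not `1`.
  · obtain ⟨T, hT, hTd⟩ := exists_isVertexCover_of_le_ringKrullDim hdim.ge
    have hTn := T.card_add_card_compl
    rw [Fintype.card_fin] at hTn
    obtain ⟨j, hjT, -⟩ := hT 0
    have hj : ∀ i, 0 < m i j := by
      intro i
      obtain ⟨l, hlT, hl⟩ := hT i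
      rw [Finset.card_le_one.1 (by omega : T.card ≤ 1) j hjT l hlT]
      exact Nat.pos_of_ne_zero hl
    have hpos : 0 < monomialGcd m j := lt_monomialGcd_apply_iff.2 hj
    rw [Ne, Finsupp.degree_eq_zero_iff]
    rintro h0
    rw [h0] at hpos
    exact lt_irrefl _ hpos

/-! ### Codimension equal to the number of generators -/

/-- Each generator needs a witness coordinate for standardness. Witnesses are non-full, and distinct
by disjointness of supports. -/
theorem card_le_of_disjoint {n q : ℕ} {m : Fin q → Fin n →₀ ℕ} {B : ℕ} (hB : ∀ i j, m i j ≤ B)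
    (hdisj : ∀ i i' j, m i j ≠ 0 → m i' j ≠ 0 → i = i') {c : Fin n → ℕ}
    (hc : c ∈ standardBox m B) : q + (fullCoords B c).card ≤ n := by
  classical
  choose f hf using (mem_standardBox.1 hc).2
  have hinj : Function.Injective f := fun i i' h =>
    hdisj i i' (f i) (Nat.ne_zero_of_lt (hf i)) (h ▸ Nat.ne_zero_of_lt (hf i'))
  have := card_add_card_fullCoords_le (B := B) (c := c) (s := Finset.univ.image f) (by
    simpa using fun i => (hf i).trans_le (hB i _))
  rwa [Finset.card_image_of_injective _ hinj, Finset.card_univ, Fintype.card_fin] at this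

theorem card_standardBox_of_disjoint {n q d : ℕ} {m : Fin q → Fin n →₀ ℕ} {B : ℕ}
    (hB : ∀ i j, m i j ≤ B) (hdisj : ∀ i i' j, m i j ≠ 0 → m i' j ≠ 0 → i = i')
    (hd : d + q = n) :
    ((standardBox m B).filter fun c => (fullCoords B c).card = d).card =
      ∏ i, (m i).degree := by
  classical
  let D : Fin q → Finset (Σ _ : Fin n, ℕ) := fun i => Finset.univ.sigma fun j => Finset.range (m i j)
  have hD : ∀ i p, p ∈ D i ↔ p.2 < m i p.1 := by
    intro i p
    simp [D]
  have hinj : ∀ f ∈ Fintype.piFinset D, Function.Injective fun i => (f i).1 := by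
    intro f hf i i' h
    have h1 := (hD _ _).1 (Fintype.mem_piFinset.1 hf i)
    have h2 := (hD _ _).1 (Fintype.mem_piFinset.1 hf i')
    dsimp only at h
    rw [← h] at h2
    exact hdisj i i' _ (Nat.ne_zero_of_lt h1) (Nat.ne_zero_of_lt h2)
  -- Place the chosen values at the chosen coordinates and `B` elsewhere.
  let F : (Fin q → Σ _ : Fin n, ℕ) → Fin n → ℕ := fun f j =>
    if h : ∃ i, (f i).1 = j then (f h.choose).2 else B
  have hF1 : ∀ f ∈ Fintype.piFinset D, ∀ i, F f (f i).1 = (f i).2 := by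
    intro f hf i
    have h : ∃ i', (f i').1 = (f i).1 := ⟨i, rfl⟩
    have h' : h.choose = i := hinj f hf h.choose_spec
    simp only [F, dif_pos h, h']
  have hF2 : ∀ f j, (∀ i, (f i).1 ≠ j) → F f j = B := by
    intro f j h
    simp only [F, dif_neg (not_exists.2 h)]
  have hprod : ∏ i, (m i).degree = (Fintype.piFinset D).card := by
    rw [Fintype.card_piFinset]
    exact Finset.prod_congr rfl fun i _ => by simp [D, Finsupp.degree_eq_sum]
  rw [hprod]
  symm
  refine Finset.card_bij (fun f _ => F f) ?_ ?_ ?_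
  · intro f hf
    have hlt : ∀ i, (f i).2 < m i (f i).1 := fun i => (hD _ _).1 (Fintype.mem_piFinset.1 hf i)
    rw [Finset.mem_filter, mem_standardBox]
    refine ⟨⟨fun j => ?_, fun i => ⟨(f i).1, ?_⟩⟩, ?_⟩
    · by_cases h : ∃ i, (f i).1 = j
      · obtain ⟨i, rfl⟩ := h
        rw [hF1 f hf]
        exact ((hlt i).trans_le (hB i _)).le
      · exact (hF2 f j (not_exists.1 h)).le
    · rw [hF1 f hf]
      exact hlt i
    · have : fullCoords B (F f) = (Finset.univ.image fun i => (f i).1)ᶜ := by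
        ext j
        simp only [fullCoords, Finset.mem_filter, Finset.mem_univ, true_and, Finset.mem_compl,
          Finset.mem_image]
        constructor
        · rintro h ⟨i, rfl⟩
          rw [hF1 f hf] at h
          exact ((hlt i).trans_le (hB i _)).ne h
        · exact fun h => hF2 f j (not_exists.1 h)
      rw [this, Finset.card_compl, Finset.card_image_of_injective _ (hinj f hf), Finset.card_univ,
        Fintype.card_fin, Fintype.card_fin]
      omega
  · intro f hf g hg h
    have hltf : ∀ i, (f i).2 < m i (f i).1 := fun i => (hD _ _).1 (Fintype.mem_piFinset.1 hf i)
    have hltg : ∀ i, (g i).2 < m i (g i).1 := fun i => (hD _ _).1 (Fintype.mem_piFinset.1 hg i)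
    funext i
    -- The coordinate chosen by `f i` is not full, so some `g i'` chooses it too. It lies in the
    -- supports of both `m i` and `m i'`, forcing `i' = i`.
    have hfst : (g i).1 = (f i).1 := by
      by_cases hex : ∃ i', (g i').1 = (f i).1
      · obtain ⟨i', hi'⟩ := hex
        have hg' := hltg i'
        rw [hi'] at hg'
        rwa [hdisj i' i _ (Nat.ne_zero_of_lt hg') (Nat.ne_zero_of_lt (hltf i))] at hi'
      · have h1 := congrFun h (f i).1
        rw [hF1 f hf, hF2 g _ (not_exists.1 hex)] at h1
        exact absurd h1 ((hltf i).trans_le (hB i _)).ne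
    have hsnd : (f i).2 = (g i).2 := by
      rw [← hF1 f hf i, ← hF1 g hg i, hfst]
      exact congrFun h _
    exact Sigma.ext hfst.symm (heq_of_eq hsnd)
  · intro c hc
    rw [Finset.mem_filter] at hc
    obtain ⟨hbox, hcard⟩ := hc
    choose f hf using (mem_standardBox.1 hbox).2
    have hmem : (fun i => ⟨f i, c (f i)⟩ : Fin q → Σ _ : Fin n, ℕ) ∈ Fintype.piFinset D :=
      Fintype.mem_piFinset.2 fun i => (hD _ _).2 (hf i)
    refine ⟨_, hmem, ?_⟩
    -- The `q` distinct witnesses exhaust the `n - d = q` non-full coordinates.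
    have himage : Finset.univ.image f = (fullCoords B c)ᶜ := by
      apply Finset.eq_of_subset_of_card_le
      · intro j hj
        obtain ⟨i, -, rfl⟩ := Finset.mem_image.1 hj
        simpa [fullCoords] using ((hf i).trans_le (hB i _)).ne
      · rw [Finset.card_compl, Finset.card_image_of_injective _ (hinj _ hmem), Finset.card_univ,
          Fintype.card_fin, Fintype.card_fin]
        omega
    funext j
    by_cases h : ∃ i, f i = j
    · obtain ⟨i, rfl⟩ := h
      exact hF1 _ hmem i
    · rw [hF2 _ j (not_exists.1 h)]
      have : j ∉ (fullCoords B c)ᶜ := by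
        rw [← himage]
        simpa using h
      symm
      simpa [fullCoords] using this

/-- The quotient has a finite dimension, hence a vertex cover exists, and no cover can meet a
constant generator. -/
theorem ne_zero_of_hasCodim {k : Type*} [Field k] {n q c : ℕ} {m : Fin q → Fin n →₀ ℕ}
    (h : HasCodim (monomialIdeal k m) c) (i : Fin q) : m i ≠ 0 := by
  obtain ⟨d, hdim, -⟩ := h.exists_ringKrullDim_eq
  obtain ⟨T, hT, -⟩ := exists_isVertexCover_of_le_ringKrullDim hdim.ge
  obtain ⟨j, -, hj⟩ := hT i
  intro h0
  exact hj (by rw [h0]; rfl)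

theorem disjoint_of_hasCodim {k : Type*} [Field k] {n q : ℕ} {m : Fin q → Fin n →₀ ℕ}
    (h : HasCodim (monomialIdeal k m) q) (i i' : Fin q) (j : Fin n) (hi : m i j ≠ 0)
    (hi' : m i' j ≠ 0) : i = i' := by
  classical
  by_contra hne
  have hex : ∀ l, ∃ j, m l j ≠ 0 := fun l => by
    by_contra! hall
    exact ne_zero_of_hasCodim h l (Finsupp.ext hall)
  choose f hf using hex
  obtain ⟨d, hdim, hdn⟩ := h.exists_ringKrullDim_eq
  -- The shared variable `j`, assigned to `i'`, also covers `m i`. Hence `q - 1` variables suffice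
  -- and the dimension is at least `n - q + 1`.
  have hcover : IsVertexCover m ((Finset.univ.erase i).image fun l =>
      if l = i' then j else f l) := by
    intro l
    by_cases hl : l = i ∨ l = i'
    · refine ⟨j, Finset.mem_image.2 ⟨i', by simp [Ne.symm hne], by simp⟩, ?_⟩
      rcases hl with rfl | rfl
      · exact hi
      · exact hi'
    · push Not at hl
      refine ⟨f l, Finset.mem_image.2 ⟨l, by simp [hl.1], by simp [hl.2]⟩, hf l⟩
  have hcard := hcover.card_compl_le_ringKrullDim k
  rw [hdim] at hcard
  have hcard' := (Nat.cast_le (α := WithBot ℕ∞)).1 hcard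
  rw [Finset.card_compl, Fintype.card_fin] at hcard'
  have himage := Finset.card_image_le (s := Finset.univ.erase i)
    (f := fun l => if l = i' then j else f l)
  rw [Finset.card_erase_of_mem (Finset.mem_univ i), Finset.card_univ, Fintype.card_fin] at himage
  have := i.pos
  omega

theorem hasMultiplicity_of_hasCodim_card {k : Type*} [Field k] {n q : ℕ}
    {m : Fin q → Fin n →₀ ℕ} (h : HasCodim (monomialIdeal k m) q) :
    HasMultiplicity (monomialIdeal k m) (∏ i, (m i).degree) := by
  obtain ⟨d, hdim, hdn⟩ := h.exists_ringKrullDim_eq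
  obtain ⟨B, hB⟩ := exists_bound_exponents m
  have hdisj := disjoint_of_hasCodim h
  refine hasMultiplicity_of_card_standardBox hB hdim ?_
    (card_standardBox_of_disjoint hB hdisj hdn) ?_
  · intro c hc
    have := card_le_of_disjoint hB hdisj hc
    omega
  · rw [Finset.prod_ne_zero_iff]
    intro i _
    rw [Ne, Finsupp.degree_eq_zero_iff]
    exact ne_zero_of_hasCodim h i

end MonomialMultiplicity

theorem theorem3p2 {k : Type*} [Field k] {n q : ℕ} (m : Fin q → Fin n →₀ ℕ) :
    (MonomialMultiplicity.HasCodim (MonomialMultiplicity.monomialIdeal k m) 1 →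
      MonomialMultiplicity.HasMultiplicity (MonomialMultiplicity.monomialIdeal k m)
        (MonomialMultiplicity.monomialGcd m).degree) ∧
    (MonomialMultiplicity.HasCodim (MonomialMultiplicity.monomialIdeal k m) q →
      RingTheory.Sequence.IsRegular (MvPolynomial (Fin n) k)
        (List.ofFn fun i => MvPolynomial.monomial (m i) (1 : k)) ∧
      MonomialMultiplicity.HasMultiplicity (MonomialMultiplicity.monomialIdeal k m)
        (∏ i, (m i).degree)) :=
  ⟨MonomialMultiplicity.hasMultiplicity_of_hasCodim_one, fun h =>
    ⟨MonomialMultiplicity.isRegular_monomials_of_disjoint k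
      (MonomialMultiplicity.ne_zero_of_hasCodim h) (MonomialMultiplicity.disjoint_of_hasCodim h),
      MonomialMultiplicity.hasMultiplicity_of_hasCodim_card h⟩⟩
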